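/- A rooted tree is finite, and it is called binary if every vertex has at most two children. A vertex $u$ of a rooted tree $T$ is an ancestor of a vertex $v$ if $u$ lies on the path from $v$ to the root (so every vertex is an ancestor of itself), and the nearest common ancestor $\mathrm{nca}_T(u,v)$ of two vertices is their unique common ancestor that is furthest from the root. An NCA-labeling scheme for a family $\mathcal{T}$ of rooted trees, with label set $[m]$ of $m$ elements, consists of an encoder $f$, which assigns to every vertex $v$ of every tree $T\in\mathcal{T}$ a label $f(v)\in[m]$, and a decoder $g:[m]\times[m]\to[m]$, such that for every $T\in\mathcal{T}$ distinct vertices of $T$ get distinct labels and $g(f(u),f(v))=f(\mathrm{nca}_T(u,v))$ for all vertices $u,v$ of $T$. Its size is $\lceil\log_2 m\rceil$, the number of bits of a label. Theorem. For every integer $n\ge 2$: 1. there is an NCA-labeling scheme of size less than $2.318\,\log_2 n$ for the family of all rooted trees with at most $n$ vertices; 2. there is an NCA-labeling scheme of size less than $1.894\,\log_2 n$ for the family of all rooted binary trees with at most $n$ vertices. -/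

import Mathlib

/-!
Rooted trees are Mathlib's `RootedTree`s: `⊥` is the root, `u ≤ v` says that `u` is an ancestor of
`v` (every vertex is an ancestor of itself), and `u ⋖ v` says that `u` is the parent of `v`.
-/

universe u

namespace RootedTree

/-- The distance of `v` from the root, i.e. the number of proper ancestors of `v`. -/
noncomputable def depth {T : RootedTree.{u}} (v : T) : ℕ :=
  (Set.Iio v).ncard

/-- The nearest common ancestor of `v` and `w`. -/
def nca {T : RootedTree.{u}} (v w : T) : T :=
  v ⊓ w

/-- In a finite rooted tree, `nca v w` is the unique common ancestor of `v` and `w` that is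
furthest from the root. -/
theorem nca_eq_iff {T : RootedTree.{u}} [Finite T] (v w x : T) :
    x = nca v w ↔ x ≤ v ∧ x ≤ w ∧ ∀ y : T, y ≤ v → y ≤ w → depth y ≤ depth x := by
  constructor
  · rintro rfl
    refine ⟨inf_le_left, inf_le_right, fun y hv hw => ?_⟩
    exact Set.ncard_le_ncard (Set.Iio_subset_Iio (le_inf hv hw)) (Set.toFinite _)
  · rintro ⟨hv, hw, h⟩
    by_contra hne
    have hlt : x < nca v w := lt_of_le_of_ne (le_inf hv hw) hne
    have hss : Set.Iio x ⊂ Set.Iio (nca v w) :=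
      ⟨Set.Iio_subset_Iio hlt.le, fun hsub => lt_irrefl x (hsub hlt)⟩
    exact absurd (h (nca v w) inf_le_left inf_le_right)
      (not_le.mpr (Set.ncard_lt_ncard hss (Set.toFinite _)))

/-- A rooted tree is binary if every vertex has at most two children. -/
def IsBinary (T : RootedTree.{u}) : Prop :=
  ∀ v : T, {c : T | v ⋖ c}.encard ≤ 2

/-- The family of all rooted trees with at most `n` vertices. -/
def treesOfSize (n : ℕ) : Set RootedTree.{u} :=
  {T | Finite T ∧ Nat.card T ≤ n}

/-- The family of all rooted binary trees with at most `n` vertices. -/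
def binaryTreesOfSize (n : ℕ) : Set RootedTree.{u} :=
  {T | T ∈ treesOfSize n ∧ T.IsBinary}

/-- An NCA-labeling scheme with `m` labels for a family of rooted trees. The decoder sees only the
two labels, not the tree. -/
structure NCALabelingScheme (𝒯 : Set RootedTree.{u}) (m : ℕ) where
  /-- The label of a vertex of a tree of the family. -/
  encode : (T : RootedTree.{u}) → T ∈ 𝒯 → T → Fin m
  /-- The label of the nearest common ancestor, computed from two labels. -/
  decode : Fin m → Fin m → Fin m
  encode_injective : ∀ (T : RootedTree.{u}) (hT : T ∈ 𝒯), Function.Injective (encode T hT)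
  decode_encode : ∀ (T : RootedTree.{u}) (hT : T ∈ 𝒯) (v w : T),
    decode (encode T hT v) (encode T hT w) = encode T hT (nca v w)

/-- The size `⌈log₂ m⌉` of a labeling scheme with `m` labels: the number of bits of a label. -/
noncomputable def NCALabelingScheme.size {𝒯 : Set RootedTree.{u}} {m : ℕ}
    (_ : NCALabelingScheme 𝒯 m) : ℕ :=
  ⌈Real.logb 2 (m : ℝ)⌉₊

end RootedTree

/-! The labels are the vertices of one universal host into which every tree of the family embeds
with its meets. The meet of a host is a bare function without axioms, so the decoder is the host's
meet and only the size of the host has to be bounded.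

To host a subtree of size at most n rooted at v, fix a threshold t and descend from v to a deepest w
that loses at most t vertices. Every child of w has at most n - t - 1 descendants, and the k-th
largest child at most (n - 1) / k, so recursively built hosts for these sizes, joined under a root,
host the subtree of w (`IsHost`, `IsBundle`). The path from v to w, with at most t vertices off the
subtree of w, is handled by a spine (`IsSpine`), which extends any host of that subtree at an
additive cost independent of it. Spines are built by halving: a vertex y of the path splits the lost
vertices into two parts of about m/2, and the off-path children of y form a bundle (`IsSpine.step`).

With hosts of size n^c/2, halving gives spines of size A m^c where A (1 - 2^(1-c)) ≥ R, R m^c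
bounding the cost at y (`isSpine_rpow`). The induction closes if A (t/n)^c + (1 - t/n)^c/2 plus the
cost of the other children is at most 1/2. For binary trees the only other child costs about
2^(-c)/2, and c = 1.894 works (`isHost_binary`); in general the others cost about (ζ(c) - 1)/2, and
c = 2.318 works (`isHost_general`). The factor 1/2 in n^c/2 saves the bit lost in rounding up
(`NCALabelingScheme.size_lt`). -/

/-! ### Host forests, disjoint unions and cones -/

/-- A finite type with a partial meet operation, the host of an embedding of a forest:
the meet of two vertices is `none` if they have no common ancestor. -/
structure HostForest where
  /-- The vertices. -/
  X : Type
  [fintype : Fintype X]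
  /-- The nearest common ancestor of two vertices, if there is one. -/
  meet : X → X → Option X

namespace HostForest

attribute [instance] HostForest.fintype

/-- The number of vertices. -/
def size (F : HostForest) : ℕ := Fintype.card F.X

/-- The meet operation with a bottom element `none` added. -/
def optMeet (F : HostForest) (a b : Option F.X) : Option F.X :=
  a.bind fun x => b.bind fun y => F.meet x y

/-- The empty forest. -/
def nil : HostForest where
  X := Empty
  meet := fun x _ => x.elim

/-- The disjoint union of two forests. -/
def sum (F G : HostForest) : HostForest where
  X := F.X ⊕ G.X
  meet
    | .inl a, .inl b => (F.meet a b).map .inl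
    | .inr a, .inr b => (G.meet a b).map .inr
    | _, _ => none

/-- The tree obtained from a forest by adding a root `none`. -/
def cone (F : HostForest) : HostForest where
  X := Option F.X
  meet := fun a b => some (F.optMeet a b)

@[simp] theorem size_nil : nil.size = 0 := rfl

@[simp] theorem size_sum (F G : HostForest) : (F.sum G).size = F.size + G.size :=
  Fintype.card_sum

@[simp] theorem size_cone (F : HostForest) : F.cone.size = F.size + 1 :=
  Fintype.card_option

/-- The inclusion of the first forest into a disjoint union. -/
def inl (F G : HostForest) : F.X → (F.sum G).X := Sum.inl

/-- The inclusion of the second forest into a disjoint union. -/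
def inr (F G : HostForest) : G.X → (F.sum G).X := Sum.inr

/-- The vertices of a cone, with the root as `none`. -/
def toCone (F : HostForest) : Option F.X → F.cone.X := id

theorem inl_injective (F G : HostForest) : Function.Injective (F.inl G) := Sum.inl_injective

theorem inr_injective (F G : HostForest) : Function.Injective (F.inr G) := Sum.inr_injective

theorem inl_ne_inr (F G : HostForest) (a : F.X) (b : G.X) : F.inl G a ≠ F.inr G b := Sum.inl_ne_inr

theorem toCone_injective (F : HostForest) : Function.Injective F.toCone := Function.injective_id

theorem optMeet_toCone (F : HostForest) (a b : Option F.X) :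
    F.cone.optMeet (some (F.toCone a)) (some (F.toCone b)) = some (F.toCone (F.optMeet a b)) := rfl

@[simp] theorem optMeet_none_right (F : HostForest) (a : Option F.X) :
    F.optMeet a none = none := by
  cases a <;> rfl

theorem optMeet_inl (F G : HostForest) (a b : Option F.X) :
    (F.sum G).optMeet (a.map (F.inl G)) (b.map (F.inl G)) = (F.optMeet a b).map (F.inl G) := by
  cases a <;> cases b <;> rfl

theorem optMeet_inr (F G : HostForest) (a b : Option G.X) :
    (F.sum G).optMeet (a.map (F.inr G)) (b.map (F.inr G)) = (G.optMeet a b).map (F.inr G) := by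
  cases a <;> cases b <;> rfl

theorem optMeet_inl_inr (F G : HostForest) (a : Option F.X) (b : Option G.X) :
    (F.sum G).optMeet (a.map (F.inl G)) (b.map (F.inr G)) = none := by
  cases a <;> cases b <;> rfl

theorem optMeet_inr_inl (F G : HostForest) (a : Option G.X) (b : Option F.X) :
    (F.sum G).optMeet (a.map (F.inr G)) (b.map (F.inl G)) = none := by
  cases a <;> cases b <;> rfl

variable {T : RootedTree.{u}}

/-- The forest `F` hosts the set `A` of vertices of `T`: there is an injection of `A` into the
vertices of `F` that commutes with meets, where meets outside `A` are sent to `none`. -/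
def Hosts (F : HostForest) (A : Set T) : Prop :=
  ∃ f : T → Option F.X, (∀ a, f a = none ↔ a ∉ A) ∧ Set.InjOn f A ∧
    ∀ a ∈ A, ∀ b ∈ A, F.optMeet (f a) (f b) = f (a ⊓ b)

theorem hosts_empty (F : HostForest) : F.Hosts (∅ : Set T) :=
  ⟨fun _ => none, by simp, by simp, by simp⟩

/-- The model case is that of descendants of distinct siblings: cross meets are the parent, which
lies in neither set, matching the value `none` across the summands. -/
theorem Hosts.sum_of_separated {F G : HostForest} {A B : Set T} (hF : F.Hosts A) (hG : G.Hosts B)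
    (hAB : ∀ a ∈ A, a ∉ B) (hA : ∀ a ∈ A, ∀ b ∈ A, a ⊓ b ∉ B) (hB : ∀ a ∈ B, ∀ b ∈ B, a ⊓ b ∉ A)
    (hm : ∀ a ∈ A, ∀ b ∈ B, a ⊓ b ∉ A ∧ a ⊓ b ∉ B) : (F.sum G).Hosts (A ∪ B) := by
  classical
  obtain ⟨f, f0, fi, fm⟩ := hF
  obtain ⟨g, g0, gi, gm⟩ := hG
  have hr : ∀ a, a ∉ A → (if a ∈ A then (f a).map (F.inl G) else (g a).map (F.inr G) :
      Option (F.sum G).X) = (g a).map (F.inr G) := fun a h => if_neg h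
  -- Outside both sets the two branches agree, since both are `none`.
  have hl : ∀ a, a ∉ B → (if a ∈ A then (f a).map (F.inl G) else (g a).map (F.inr G) :
      Option (F.sum G).X) = (f a).map (F.inl G) := by
    intro a h
    split_ifs with h'
    · rfl
    · rw [(f0 a).2 h', (g0 a).2 h]; rfl
  refine ⟨fun a => if a ∈ A then (f a).map (F.inl G) else (g a).map (F.inr G), ?_, ?_, ?_⟩
  · intro a
    by_cases h : a ∈ A
    · simpa [h] using (f0 a).not.2 (not_not.2 h)
    · simpa [h] using g0 a
  · rintro a (ha | ha) b (hb | hb) h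
    · dsimp only at h
      rw [hl a (hAB a ha), hl b (hAB b hb)] at h
      exact fi ha hb (Option.map_injective (F.inl_injective G) h)
    · dsimp only at h
      rw [hl a (hAB a ha), hr b (fun h => hAB b h hb)] at h
      have h1 := (f0 a).not.2 (not_not.2 ha)
      cases hfa : f a <;> cases hgb : g b <;> simp_all [inl_ne_inr]
    · dsimp only at h
      rw [hl b (hAB b hb), hr a (fun h => hAB a h ha)] at h
      have h1 := (f0 b).not.2 (not_not.2 hb)
      cases hfa : f b <;> cases hgb : g a <;> simp_all [(inl_ne_inr F G _ _).symm]
    · dsimp only at h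
      rw [hr a (fun h => hAB a h ha), hr b (fun h => hAB b h hb)] at h
      exact gi ha hb (Option.map_injective (F.inr_injective G) h)
  · rintro a (ha | ha) b (hb | hb)
    · dsimp only
      rw [hl a (hAB a ha), hl b (hAB b hb), hl _ (hA a ha b hb), optMeet_inl, fm a ha b hb]
    · dsimp only
      rw [hl a (hAB a ha), hr b (fun h => hAB b h hb), optMeet_inl_inr, hl _ (hm a ha b hb).2,
        (f0 _).2 (hm a ha b hb).1]
      rfl
    · dsimp only
      rw [inf_comm, hl b (hAB b hb), hr a (fun h => hAB a h ha), optMeet_inr_inl,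
        hl _ (hm b hb a ha).2, (f0 _).2 (hm b hb a ha).1]
      rfl
    · dsimp only
      rw [hr a (fun h => hAB a h ha), hr b (fun h => hAB b h hb), hr _ (hB a ha b hb),
        optMeet_inr, gm a ha b hb]

theorem Hosts.sum_left {F : HostForest} {A : Set T} (hF : F.Hosts A) (G : HostForest) :
    (F.sum G).Hosts A := by
  simpa using hF.sum_of_separated (hosts_empty G) (by simp) (by simp) (by simp) (by simp)

theorem Hosts.sum_right {G : HostForest} {A : Set T} (F : HostForest) (hG : G.Hosts A) :
    (F.sum G).Hosts A := by
  simpa using (hosts_empty F).sum_of_separated hG (by simp) (by simp) (by simp) (by simp)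

/-- The value `none`, which in `F` marks a meet outside `A`, becomes the root of the cone, and `v`
is placed there. -/
theorem Hosts.cone_insert {F : HostForest} {A : Set T} {v : T} (hF : F.Hosts A) (hv : v ∉ A)
    (hle : ∀ a ∈ A, v ≤ a) (hA : ∀ a ∈ A, ∀ b ∈ A, a ⊓ b ∈ A ∨ a ⊓ b = v) :
    F.cone.Hosts (insert v A) := by
  classical
  obtain ⟨f, f0, fi, fm⟩ := hF
  have hfv : f v = none := (f0 v).2 hv
  have hle' : ∀ a ∈ insert v A, v ≤ a := by
    rintro a (rfl | ha)
    exacts [le_rfl, hle a ha]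
  refine ⟨fun a => if a ∈ insert v A then some (F.toCone (f a)) else none, by simp, ?_, ?_⟩
  · intro a ha b hb h
    simp only [ha, hb, if_true] at h
    replace h := F.toCone_injective (Option.some_injective _ h)
    rcases ha with rfl | ha <;> rcases hb with rfl | hb
    · rfl
    · exact absurd (h.symm.trans hfv) ((f0 b).not.2 (not_not.2 hb))
    · exact absurd (h.trans hfv) ((f0 a).not.2 (not_not.2 ha))
    · exact fi ha hb h
  · intro a ha b hb
    have hab : a ⊓ b ∈ insert v A := by
      rcases ha with rfl | ha
      · left; exact inf_eq_left.2 (hle' b hb)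
      · rcases hb with rfl | hb
        · left; exact inf_eq_right.2 (hle a ha)
        · exact (hA a ha b hb).symm
    simp only [ha, hb, hab, if_true]
    rw [optMeet_toCone]
    congr 2
    rcases ha with rfl | ha
    · rw [inf_eq_left.2 (hle' b hb), hfv]; rfl
    · rcases hb with rfl | hb
      · rw [inf_eq_right.2 (hle a ha), hfv, optMeet_none_right]
      · exact fm a ha b hb

/-- Here the new root stays unoccupied; this serves spines in which the path is a single vertex. -/
theorem Hosts.cone_of_infClosed {F : HostForest} {A : Set T} (hF : F.Hosts A)
    (hA : InfClosed A) : F.cone.Hosts A := by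
  obtain ⟨f, f0, fi, fm⟩ := hF
  refine ⟨fun a => (f a).map fun x => F.toCone (some x), by simpa using f0, fun a ha b hb h =>
    fi ha hb (Option.map_injective (F.toCone_injective.comp (Option.some_injective _)) h), fun a ha b hb => ?_⟩
  have h1 := (f0 a).not.2 (not_not.2 ha)
  have h2 := (f0 b).not.2 (not_not.2 hb)
  have h3 := (f0 (a ⊓ b)).not.2 (not_not.2 (hA ha hb))
  have h4 := fm a ha b hb
  dsimp only
  rw [← h4] at h3 ⊢
  obtain ⟨x, hx⟩ := Option.ne_none_iff_exists'.1 h1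
  obtain ⟨y, hy⟩ := Option.ne_none_iff_exists'.1 h2
  rw [hx, hy] at h3 ⊢
  obtain ⟨z, hz⟩ := Option.ne_none_iff_exists'.1 h3
  simp only [Option.map_some, optMeet_toCone, hz]

end HostForest


/-! ### Subtree sizes and subtrees of siblings -/

namespace RootedTree

variable {T : RootedTree.{u}}

/-- The number of vertices of the subtree of descendants of `v`. -/
noncomputable def subtreeSize (v : T) : ℕ := (Set.Ici v).ncard

/-- The vertices that have an ancestor in `C`. -/
def below (C : Finset T) : Set T := {x | ∃ c ∈ C, c ≤ x}

/-- Every vertex has at most `D` children. -/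
def DegreeLE (D : ℕ) (T : RootedTree.{u}) : Prop := ∀ v : T, {c : T | v ⋖ c}.encard ≤ D

theorem eq_of_covBy_of_le {v c d x : T} (hc : v ⋖ c) (hd : v ⋖ d) (hcx : c ≤ x) (hdx : d ≤ x) :
    c = d := by
  rcases (le_total_of_directed hcx hdx).symm with h | h
  · by_contra hne
    exact hd.2 hc.1 (lt_of_le_of_ne h hne)
  · by_contra hne
    exact hc.2 hd.1 (lt_of_le_of_ne h (Ne.symm hne))

theorem below_singleton (c : T) : below {c} = Set.Ici c := by
  ext x; simp [below]

theorem below_union [DecidableEq T] (C D : Finset T) : below (C ∪ D) = below C ∪ below D := by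
  ext x
  simp only [below, Finset.mem_union, Set.mem_ofPred_eq, Set.mem_union]
  grind

theorem notMem_below {v : T} {C : Finset T} (hC : ∀ c ∈ C, v ⋖ c) : v ∉ below C := by
  rintro ⟨c, hc, hcv⟩
  exact (hC c hc).1.not_ge hcv

theorem DegreeLE.card_le {D : ℕ} (hT : DegreeLE D T) {v : T} {C : Finset T}
    (hC : ∀ c ∈ C, v ⋖ c) : C.card ≤ D := by
  have h := (Set.encard_le_encard (show (C : Set T) ⊆ {c : T | v ⋖ c} from hC)).trans (hT v)
  rw [Set.encard_coe_eq_coe_finsetCard] at h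
  exact_mod_cast h

section Finite

variable [Finite T]

theorem inf_eq_of_covBy_of_ne {v c d a b : T} (hc : v ⋖ c) (hd : v ⋖ d) (hca : c ≤ a)
    (hdb : d ≤ b) (hne : c ≠ d) : a ⊓ b = v := by
  by_contra h
  have hlt : v < a ⊓ b :=
    lt_of_le_of_ne (le_inf (hc.le.trans hca) (hd.le.trans hdb)) (Ne.symm h)
  obtain ⟨e, he, hle⟩ := exists_covBy_le_of_lt hlt
  exact hne ((eq_of_covBy_of_le hc he hca (hle.trans inf_le_left)).trans
    (eq_of_covBy_of_le he hd (hle.trans inf_le_right) hdb))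

theorem subtreeSize_anti {v w : T} (h : v ≤ w) : subtreeSize w ≤ subtreeSize v :=
  Set.ncard_le_ncard (Set.Ici_subset_Ici.2 h) (Set.toFinite _)

theorem subtreeSize_lt {v w : T} (h : v < w) : subtreeSize w < subtreeSize v :=
  Set.ncard_lt_ncard ⟨Set.Ici_subset_Ici.2 h.le, fun hs => h.not_ge (hs le_rfl)⟩ (Set.toFinite _)

theorem subtreeSize_pos (v : T) : 0 < subtreeSize v :=
  (Set.ncard_pos (Set.toFinite _)).2 ⟨v, le_rfl⟩

/-- Subtrees of siblings are disjoint and miss `v`; this one missed vertex is the source of the `n -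
1` and `m - 1` in the recursion. -/
theorem sum_subtreeSize_lt {v : T} {C : Finset T} (hC : ∀ c ∈ C, v ⋖ c) :
    ∑ c ∈ C, subtreeSize c < subtreeSize v := by
  classical
  have := Fintype.ofFinite T
  have hcard : ∀ c : T, subtreeSize c = (Finset.univ.filter (c ≤ ·)).card := fun c => by
    rw [subtreeSize, ← Set.ncard_coe_finset]
    congr 1; ext x; simp
  simp only [hcard]
  rw [← Finset.card_biUnion]
  · refine Finset.card_lt_card ⟨?_, fun hs => ?_⟩
    · intro x hx
      simp only [Finset.mem_biUnion, Finset.mem_filter, Finset.mem_univ, true_and] at hx ⊢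
      obtain ⟨c, hc, hcx⟩ := hx
      exact (hC c hc).le.trans hcx
    · have hv := hs (show v ∈ _ by simp)
      simp only [Finset.mem_biUnion, Finset.mem_filter, Finset.mem_univ, true_and] at hv
      obtain ⟨c, hc, hcv⟩ := hv
      exact (hC c hc).1.not_ge hcv
  · intro c hc d hd hne
    simp only [Function.onFun, Finset.disjoint_left, Finset.mem_filter, Finset.mem_univ, true_and]
    exact fun x h h' => hne (eq_of_covBy_of_le (hC c hc) (hC d hd) h h')

theorem exists_children (v : T) : ∃ C : Finset T, ∀ c, c ∈ C ↔ v ⋖ c :=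
  ⟨(Set.toFinite {c : T | v ⋖ c}).toFinset, by simp⟩

theorem insert_below_eq_Ici {v : T} {C : Finset T} (hC : ∀ c, c ∈ C ↔ v ⋖ c) :
    insert v (below C) = Set.Ici v := by
  ext x
  simp only [Set.mem_insert_iff, below, Set.mem_ofPred_eq, Set.mem_Ici]
  constructor
  · rintro (rfl | ⟨c, hc, hcx⟩)
    exacts [le_rfl, ((hC c).1 hc).le.trans hcx]
  · intro h
    rcases h.eq_or_lt with rfl | h
    · exact Or.inl rfl
    · obtain ⟨c, hc, hcx⟩ := exists_covBy_le_of_lt h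
      exact Or.inr ⟨c, (hC c).2 hc, hcx⟩

theorem inf_mem_below_or_eq {v a b : T} {C : Finset T} (hC : ∀ c ∈ C, v ⋖ c)
    (ha : a ∈ below C) (hb : b ∈ below C) : a ⊓ b ∈ below C ∨ a ⊓ b = v := by
  obtain ⟨c, hc, hca⟩ := ha
  obtain ⟨d, hd, hdb⟩ := hb
  rcases eq_or_ne c d with rfl | hne
  · exact Or.inl ⟨c, hc, le_inf hca hdb⟩
  · exact Or.inr (inf_eq_of_covBy_of_ne (hC c hc) (hC d hd) hca hdb hne)

end Finite

end RootedTree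

/-! ### Hosting the descendants of a vertex from those of its children -/

namespace HostForest

open RootedTree

variable {T : RootedTree.{u}} [Finite T]

theorem Hosts.sum_below [DecidableEq T] {F G : HostForest} {v : T} {C D : Finset T}
    (hC : ∀ c ∈ C, v ⋖ c) (hD : ∀ c ∈ D, v ⋖ c) (hCD : Disjoint C D)
    (hF : F.Hosts (below C)) (hG : G.Hosts (below D)) : (F.sum G).Hosts (below (C ∪ D)) := by
  have hdis : ∀ a ∈ below C, a ∉ below D := by
    rintro a ⟨c, hc, hca⟩ ⟨d, hd, hda⟩
    have := eq_of_covBy_of_le (hC c hc) (hD d hd) hca hda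
    exact Finset.disjoint_left.1 hCD hc (this ▸ hd)
  have hinf : ∀ a ∈ below C, ∀ b ∈ below D, a ⊓ b = v := by
    rintro a ⟨c, hc, hca⟩ b ⟨d, hd, hdb⟩
    exact inf_eq_of_covBy_of_ne (hC c hc) (hD d hd) hca hdb
      fun h => Finset.disjoint_left.1 hCD hc (h ▸ hd)
  rw [below_union]
  refine hF.sum_of_separated hG hdis ?_ ?_ ?_
  · intro a ha b hb
    rcases inf_mem_below_or_eq hC ha hb with h | h
    · exact hdis _ h
    · rw [h]; exact notMem_below hD
  · intro a ha b hb
    rcases inf_mem_below_or_eq hD ha hb with h | h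
    · exact fun h' => hdis _ h' h
    · rw [h]; exact notMem_below hC
  · intro a ha b hb
    rw [hinf a ha b hb]
    exact ⟨notMem_below hC, notMem_below hD⟩

theorem Hosts.cone_below {F : HostForest} {v : T} {C : Finset T} (hC : ∀ c, c ∈ C ↔ v ⋖ c)
    (hF : F.Hosts (below C)) : F.cone.Hosts (Set.Ici v) := by
  have hC' : ∀ c ∈ C, v ⋖ c := fun c => (hC c).1
  rw [← insert_below_eq_Ici hC]
  refine hF.cone_insert (notMem_below hC') ?_ fun a ha b hb => inf_mem_below_or_eq hC' ha hb
  rintro a ⟨c, hc, hca⟩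
  exact (hC' c hc).le.trans hca

end HostForest

/-! ### The recursion for hosts, bundles and spines -/

namespace RootedTree

open HostForest

/-- Some forest with at most `x` vertices hosts every subtree with at most `n` vertices of a tree
with at most `D` children per vertex. -/
def IsHost (D n : ℕ) (x : ℝ) : Prop :=
  ∃ F : HostForest, (F.size : ℝ) ≤ x ∧ ∀ T : RootedTree.{u}, Finite T → DegreeLE D T →
    ∀ v : T, subtreeSize v ≤ n → F.Hosts (Set.Ici v)

/-- Some forest with at most `x` vertices hosts the subtrees of any at most `k` siblings, provided
that these have at most `N` vertices in total and at most `M` vertices each. -/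
def IsBundle (D k N M : ℕ) (x : ℝ) : Prop :=
  ∃ F : HostForest, (F.size : ℝ) ≤ x ∧ ∀ T : RootedTree.{u}, Finite T → DegreeLE D T →
    ∀ (v : T) (C : Finset T), (∀ c ∈ C, v ⋖ c) → C.card ≤ k → ∑ c ∈ C, subtreeSize c ≤ N →
      (∀ c ∈ C, subtreeSize c ≤ M) → F.Hosts (below C)

/-- Every host of the subtree of a vertex `w` extends by at most `s` vertices to a host of the
subtree of any ancestor of `w` with at most `m` descendants that are not descendants of `w`. -/
def IsSpine (D m : ℕ) (s : ℝ) : Prop :=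
  ∀ G : HostForest, ∃ G' : HostForest, (G'.size : ℝ) ≤ s + G.size ∧
    ∀ T : RootedTree.{u}, Finite T → DegreeLE D T → ∀ v w : T, v ≤ w →
      subtreeSize v ≤ subtreeSize w + m → G.Hosts (Set.Ici w) → G'.Hosts (Set.Ici v)

variable {D : ℕ}

theorem IsHost.mono {n n' : ℕ} {x y : ℝ} (h : IsHost.{u} D n x) (hn : n' ≤ n) (hxy : x ≤ y) :
    IsHost.{u} D n' y :=
  let ⟨F, hF, H⟩ := h
  ⟨F, hF.trans hxy, fun T hT hD v hv => H T hT hD v (hv.trans hn)⟩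

theorem IsBundle.mono {k N M : ℕ} {x y : ℝ} (h : IsBundle.{u} D k N M x) (hxy : x ≤ y) :
    IsBundle.{u} D k N M y :=
  let ⟨F, hF, H⟩ := h
  ⟨F, hF.trans hxy, H⟩

theorem IsSpine.mono {m : ℕ} {x y : ℝ} (h : IsSpine.{u} D m x) (hxy : x ≤ y) :
    IsSpine.{u} D m y := fun G =>
  let ⟨F, hF, H⟩ := h G
  ⟨F, hF.trans (by linarith), H⟩

theorem isHost_zero : IsHost.{u} D 0 0 :=
  ⟨nil, by simp, fun T _ _ v hv => absurd hv (subtreeSize_pos v).not_ge⟩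

theorem isBundle_zero (N M : ℕ) : IsBundle.{u} D 0 N M 0 := by
  refine ⟨nil, by simp, fun T _ _ v C _ hC _ _ => ?_⟩
  rw [Nat.le_zero, Finset.card_eq_zero] at hC
  have : below C = ∅ := by ext x; simp [below, hC]
  rw [this]
  exact hosts_empty _

/-- The smallest of `k + 1` siblings has at most the average size, so it goes into the new host and
the others into the old bundle. -/
theorem IsBundle.succ {k N M : ℕ} {x y : ℝ} (hb : IsBundle.{u} D k N M x)
    (hh : IsHost.{u} D (min M (N / (k + 1))) y) : IsBundle.{u} D (k + 1) N M (x + y) := by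
  classical
  obtain ⟨F, hF, HF⟩ := hb
  obtain ⟨G, hG, HG⟩ := hh
  refine ⟨F.sum G, by rw [size_sum]; push_cast; linarith, fun T hT hD v C hC hk hN hM => ?_⟩
  rcases Nat.lt_or_ge k C.card with hlt | hle
  · have hcard : C.card = k + 1 := by omega
    have hne : C.Nonempty := Finset.card_pos.1 (by omega)
    obtain ⟨c, hc, hmin⟩ := C.exists_min_image subtreeSize hne
    have h1 : C.card * subtreeSize c ≤ ∑ c ∈ C, subtreeSize c := by
      rw [← smul_eq_mul]
      exact Finset.card_nsmul_le_sum _ _ _ hmin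
    have h2 : subtreeSize c ≤ N / (k + 1) := by
      rw [Nat.le_div_iff_mul_le k.add_one_pos, mul_comm, ← hcard]
      exact h1.trans hN
    have h3 := HF T hT hD v (C.erase c) (fun d hd => hC d (Finset.mem_of_mem_erase hd))
      (by rw [Finset.card_erase_of_mem hc]; omega)
      ((Finset.sum_le_sum_of_subset (Finset.erase_subset c C)).trans hN)
      (fun d hd => hM d (Finset.mem_of_mem_erase hd))
    have h4 := HG T hT hD c (le_min (hM c hc) h2)
    rw [← below_singleton] at h4
    have h5 := Hosts.sum_below (fun d hd => hC d (Finset.mem_of_mem_erase hd))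
      (D := {c}) (by simpa using hC c hc) (by simp) h3 h4
    rwa [Finset.union_comm, ← Finset.insert_eq, Finset.insert_erase hc] at h5
  · exact (HF T hT hD v C hC hle hN hM).sum_left G

theorem isSpine_zero : IsSpine.{u} D 0 0 := fun G => by
  refine ⟨G, by simp, fun T hT _ v w hvw h hG => ?_⟩
  rcases hvw.eq_or_lt with rfl | hlt
  · exact hG
  · exact absurd h (subtreeSize_lt hlt).not_ge

/-- The path is cut at the deepest `y` above `w` that loses at most `(m - 1) / 2` vertices. Its
child `z` towards `w` loses more, which leaves at most `m / 2` between `z` and `w`. The other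
children of `y` have at most `m - 1` vertices in total. -/
theorem IsSpine.step {m : ℕ} {s s' x : ℝ} (hm : 0 < m) (h : IsSpine.{u} D ((m - 1) / 2) s)
    (h' : IsSpine.{u} D (m / 2) s') (hb : IsBundle.{u} D (D - 1) (m - 1) (m - 1) x) :
    IsSpine.{u} D m (s + (s' + (1 + x))) := by
  classical
  intro G
  obtain ⟨B, hB, HB⟩ := hb
  obtain ⟨G₂, hG₂, HG₂⟩ := h' G
  obtain ⟨G₁, hG₁, HG₁⟩ := h (B.sum G₂).cone
  refine ⟨G₁, ?_, fun T hT hD v w hvw hsz hG => ?_⟩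
  · rw [size_cone, size_sum] at hG₁
    push_cast at hG₁
    linarith
  -- If `v = w`, there is no vertex to cut at, and the host is embedded in the larger one with the
  -- cone's root unused.
  rcases hvw.eq_or_lt with rfl | hlt
  · refine HG₁ T hT hD v v le_rfl (by omega) ?_
    refine ((HG₂ T hT hD v v le_rfl (by omega) hG).sum_right B).cone_of_infClosed ?_
    exact fun a ha b hb => le_inf ha hb
  obtain ⟨y, hy⟩ := Set.Finite.exists_maximal
    (Set.toFinite {y : T | v ≤ y ∧ y < w ∧ subtreeSize v ≤ subtreeSize y + (m - 1) / 2})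
    ⟨v, le_rfl, hlt, by omega⟩
  obtain ⟨⟨hvy, hyw, hy1⟩, hmax⟩ := hy
  obtain ⟨z, hyz, hzw⟩ := exists_covBy_le_of_lt hyw
  have hz : subtreeSize z ≤ subtreeSize w + m / 2 := by
    rcases hzw.eq_or_lt with rfl | hzw
    · omega
    · have : ¬ subtreeSize v ≤ subtreeSize z + (m - 1) / 2 := fun hle =>
        -- By maximality of `y`; then `m - (m - 1) / 2 - 1 = m / 2` in natural numbers.
        hyz.1.not_ge (hmax ⟨hvy.trans hyz.le, hzw, hle⟩ hyz.le)
      omega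
  obtain ⟨C, hC⟩ := exists_children y
  have hzC : z ∈ C := (hC z).2 hyz
  have hC' : ∀ c ∈ C, y ⋖ c := fun c => (hC c).1
  have hsum := sum_subtreeSize_lt hC'
  rw [← Finset.add_sum_erase C _ hzC] at hsum
  have hyv := subtreeSize_anti hvy
  have hwz := subtreeSize_anti hzw
  have hN : ∑ c ∈ C.erase z, subtreeSize c ≤ m - 1 := by omega
  have h3 := HB T hT hD y (C.erase z) (fun d hd => hC' d (Finset.mem_of_mem_erase hd))
    (by rw [Finset.card_erase_of_mem hzC]; have := hD.card_le hC'; omega) hN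
    (fun d hd => (Finset.single_le_sum (fun _ _ => Nat.zero_le _) hd).trans hN)
  have h4 := HG₂ T hT hD z w hzw hz hG
  rw [← below_singleton] at h4
  have h5 := Hosts.sum_below (fun d hd => hC' d (Finset.mem_of_mem_erase hd))
    (D := {z}) (by simpa using hyz) (by simp) h3 h4
  rw [Finset.union_comm, ← Finset.insert_eq, Finset.insert_erase hzC] at h5
  exact HG₁ T hT hD v y hvy hy1 (h5.cone_below hC)

/-- Since `w` is a deepest vertex losing at most `t`, each child of `w` loses more than `t`, hence
the cap `n - t - 1` on its size. -/
theorem IsSpine.isHost {n t : ℕ} {s x : ℝ} (h : IsSpine.{u} D t s)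
    (hb : IsBundle.{u} D D (n - 1) (n - t - 1) x) : IsHost.{u} D n (s + (1 + x)) := by
  obtain ⟨B, hB, HB⟩ := hb
  obtain ⟨G, hG, HG⟩ := h B.cone
  refine ⟨G, ?_, fun T hT hD v hv => ?_⟩
  · rw [size_cone] at hG
    push_cast at hG
    linarith
  obtain ⟨w, hw⟩ := Set.Finite.exists_maximal
    (Set.toFinite {w : T | v ≤ w ∧ subtreeSize v ≤ subtreeSize w + t}) ⟨v, le_rfl, by omega⟩
  obtain ⟨⟨hvw, hw1⟩, hmax⟩ := hw
  obtain ⟨C, hC⟩ := exists_children w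
  have hC' : ∀ c ∈ C, w ⋖ c := fun c => (hC c).1
  have hsum := sum_subtreeSize_lt hC'
  have hwv := subtreeSize_anti hvw
  refine HG T hT hD v w hvw hw1 (Hosts.cone_below hC (HB T hT hD w C hC' (hD.card_le hC')
    (by omega) fun c hc => ?_))
  have : ¬ subtreeSize v ≤ subtreeSize c + t := fun hle =>
    (hC' c hc).1.not_ge (hmax ⟨hvw.trans (hC' c hc).le, hle⟩ (hC' c hc).le)
  omega

/-- Hosts of all sizes up to `min M N` yield bundles. -/
theorem isBundle_sum {h : ℕ → ℝ} {N M : ℕ} (hh : ∀ j ≤ M, j ≤ N → IsHost.{u} D j (h j)) (k : ℕ) :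
    IsBundle.{u} D k N M (∑ i ∈ Finset.range k, h (min M (N / (i + 1)))) := by
  induction k with
  | zero => simpa using isBundle_zero N M
  | succ k ih =>
    rw [Finset.sum_range_succ]
    exact ih.succ (hh _ (min_le_left _ _) ((min_le_right _ _).trans (Nat.div_le_self _ _)))

/-- A host of all trees with at most `n` vertices is a labeling scheme. -/
theorem IsHost.exists_scheme {n : ℕ} {x : ℝ} (h : IsHost.{u} D n x) (𝒯 : Set RootedTree.{u})
    (h𝒯 : ∀ T ∈ 𝒯, T ∈ treesOfSize n ∧ DegreeLE D T) :
    ∃ (m : ℕ) (_ : NCALabelingScheme 𝒯 m), (m : ℝ) ≤ x := by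
  obtain ⟨F, hF, H⟩ := h
  have H' : ∀ T ∈ 𝒯, ∃ f : T → F.X, Function.Injective f ∧
      ∀ v w, F.meet (f v) (f w) = some (f (v ⊓ w)) := by
    intro T hT
    obtain ⟨⟨hfin, hcard⟩, hD⟩ := h𝒯 T hT
    have huniv : Set.Ici (⊥ : T) = Set.univ := Set.Ici_bot
    obtain ⟨f, f0, fi, fm⟩ := H T hfin hD ⊥ (by rwa [subtreeSize, huniv, Set.ncard_univ])
    rw [huniv] at f0 fi fm
    have hsome : ∀ a, ∃ b, f a = some b := fun a =>
      Option.ne_none_iff_exists'.1 ((f0 a).not.2 (by simp))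
    choose g hg using hsome
    refine ⟨g, fun a b hab => fi (Set.mem_univ a) (Set.mem_univ b) (by rw [hg, hg, hab]), ?_⟩
    intro v w
    have := fm v (Set.mem_univ v) w (Set.mem_univ w)
    rw [hg, hg, hg] at this
    exact this
  choose f fi fm using H'
  let e : F.X ≃ Fin F.size := Fintype.equivFin F.X
  exact ⟨F.size, {
    encode := fun T hT v => e (f T hT v)
    -- The default `a` is irrelevant: labels of vertices of one tree always have a meet in `F`.
    decode := fun a b => ((F.meet (e.symm a) (e.symm b)).map e).getD a
    encode_injective := fun T hT => e.injective.comp (fi T hT)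
    decode_encode := fun T hT v w => by simp [fm, nca] }, hF⟩

end RootedTree


/-! ### Numerical comparison of rational powers -/

set_option exponentiation.threshold 2000

section RationalPowers

/-- With 1.894 = 947/500 and 2.318 = 1159/500, numerical bounds become inequalities between natural
powers of rationals. -/
theorem Real.rpow_le_of_pow_le_pow {x y e : ℝ} {p q : ℕ} (hx : 0 ≤ x) (hy : 0 ≤ y) (hq : q ≠ 0)
    (he : e = p / q) (h : x ^ p ≤ y ^ q) : x ^ e ≤ y := by
  rw [← pow_le_pow_iff_left₀ (Real.rpow_nonneg hx _) hy hq, ← Real.rpow_natCast (x ^ e),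
    ← Real.rpow_mul hx, he, div_mul_cancel₀ _ (by exact_mod_cast hq), Real.rpow_natCast]
  exact h

theorem Real.le_rpow_of_pow_le_pow {x y e : ℝ} {p q : ℕ} (hx : 0 ≤ x) (hy : 0 ≤ y) (hq : q ≠ 0)
    (he : e = p / q) (h : y ^ q ≤ x ^ p) : y ≤ x ^ e := by
  rw [← pow_le_pow_iff_left₀ hy (Real.rpow_nonneg hx _) hq, ← Real.rpow_natCast (x ^ e),
    ← Real.rpow_mul hx, he, div_mul_cancel₀ _ (by exact_mod_cast hq), Real.rpow_natCast]
  exact h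

end RationalPowers

/-! ### Solving the spine recurrence -/

namespace RootedTree

/-- Both halves have parameter at most `m / 2`, so they cost at most `2 A (m / 2) ^ c` together;
`hA` leaves room for `R * m ^ c`, from which the root of the cone takes 1. -/
theorem isSpine_rpow {D : ℕ} {c A R : ℝ} (hc : 0 < c) (hA0 : 0 ≤ A)
    (hA : 2 * A * (1 / 2 : ℝ) ^ c + R ≤ A) {m₀ n : ℕ}
    (hbase : ∀ m, 0 < m → m < m₀ → m ≤ n → IsSpine.{u} D m (A * (m : ℝ) ^ c))
    (hstep : ∀ m, m₀ ≤ m → m ≤ n →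
      IsBundle.{u} D (D - 1) (m - 1) (m - 1) (R * (m : ℝ) ^ c - 1)) :
    ∀ m ≤ n, IsSpine.{u} D m (A * (m : ℝ) ^ c) := by
  intro m
  induction m using Nat.strong_induction_on with
  | _ m ih =>
  intro hmn
  rcases Nat.eq_zero_or_pos m with rfl | hm
  · refine isSpine_zero.mono ?_
    simp [Real.zero_rpow hc.ne']
  rcases Nat.lt_or_ge m m₀ with hlt | hge
  · exact hbase m hm hlt hmn
  refine (IsSpine.step hm (ih ((m - 1) / 2) (by omega) (by omega))
    (ih (m / 2) (by omega) (by omega)) (hstep m hge hmn)).mono ?_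
  have hhalf : ∀ k : ℕ, 2 * k ≤ m → (k : ℝ) ^ c ≤ (1 / 2 : ℝ) ^ c * (m : ℝ) ^ c := fun k hk => by
    rw [← Real.mul_rpow (by norm_num) (by positivity)]
    refine Real.rpow_le_rpow (by positivity) ?_ hc.le
    have : (2 * k : ℝ) ≤ m := by exact_mod_cast hk
    linarith
  have h1 := mul_le_mul_of_nonneg_left (hhalf ((m - 1) / 2) (by omega)) hA0
  have h2 := mul_le_mul_of_nonneg_left (hhalf (m / 2) (by omega)) hA0
  have h3 := mul_le_mul_of_nonneg_right hA (Real.rpow_nonneg (Nat.cast_nonneg m) c)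
  linarith

theorem IsHost.isBundle_one {D N : ℕ} {x : ℝ} (h : IsHost.{u} D N x) :
    IsBundle.{u} D 1 N N x := by
  simpa using (isBundle_zero N N).succ (h.mono (min_le_left _ _) le_rfl)

theorem IsHost.isBundle_two {D N M : ℕ} {x y : ℝ} (h : IsHost.{u} D M x)
    (h' : IsHost.{u} D (N / 2) y) : IsBundle.{u} D 2 N M (x + y) := by
  simpa using ((isBundle_zero N M).succ (h.mono (min_le_left _ _) le_rfl)).succ
    (h'.mono (min_le_right _ _) le_rfl)

/-- This is the threshold `t = 0`, with a trivial spine; it is used for small `n`. -/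
theorem IsHost.binary_step {n : ℕ} {x y : ℝ} (h : IsHost.{u} 2 (n - 1) x)
    (h' : IsHost.{u} 2 ((n - 1) / 2) y) : IsHost.{u} 2 n (1 + (x + y)) := by
  simpa using isSpine_zero.isHost (n := n) (h.isBundle_two h')

/-! ### Binary trees, exponent 1.894 -/

section Binary

/-- Halved, the 2 is the single vertex added as a root; it is absorbed by the rounding in `m - 1`
and `(n - 1) / 2`. By Bernoulli the gain is at least `0.947 * y ^ 0.894`. -/
theorem rpow_add_two_le {y : ℝ} (hy : 3 ≤ y) :
    y ^ (1.894 : ℝ) + 2 ≤ (y + 1 / 2) ^ (1.894 : ℝ) := by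
  have hy0 : 0 < y := by linarith
  have h1 : (2.2 : ℝ) ≤ (3 : ℝ) ^ (0.894 : ℝ) :=
    Real.le_rpow_of_pow_le_pow (p := 447) (q := 500) (by norm_num) (by norm_num) (by norm_num)
      (by norm_num) (by norm_num)
  have h2 : (3 : ℝ) ^ (0.894 : ℝ) ≤ y ^ (0.894 : ℝ) :=
    Real.rpow_le_rpow (by norm_num) hy (by norm_num)
  have h3 : y ^ (1.894 : ℝ) = y ^ (0.894 : ℝ) * y := by
    rw [← Real.rpow_add_one hy0.ne']; norm_num
  have h4 : (y + 1 / 2) = y * (1 + 1 / (2 * y)) := by field_simp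
  have h5 : 1 + (1.894 : ℝ) * (1 / (2 * y)) ≤ (1 + 1 / (2 * y)) ^ (1.894 : ℝ) :=
    one_add_mul_self_le_rpow_one_add (by have : 0 < 1 / (2 * y) := by positivity
                                         linarith) (by norm_num)
  rw [h4, Real.mul_rpow hy0.le (by positivity)]
  have h6 := mul_le_mul_of_nonneg_left h5 (Real.rpow_nonneg hy0.le (1.894 : ℝ))
  refine le_trans ?_ h6
  have h7 : y ^ (1.894 : ℝ) * (1 + (1.894 : ℝ) * (1 / (2 * y))) =
      y ^ (1.894 : ℝ) + 0.947 * y ^ (0.894 : ℝ) := by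
    rw [h3]; field_simp; ring
  rw [h7]
  linarith

theorem half_rpow_binary_le : (1 / 2 : ℝ) ^ (1.894 : ℝ) ≤ 0.26907 :=
  Real.rpow_le_of_pow_le_pow (p := 947) (q := 500) (by norm_num) (by norm_num) (by norm_num)
    (by norm_num) (by norm_num)

theorem seven_tenths_rpow_le : (0.7 : ℝ) ^ (1.894 : ℝ) ≤ 0.50889 :=
  Real.rpow_le_of_pow_le_pow (p := 947) (q := 500) (by norm_num) (by norm_num) (by norm_num)
    (by norm_num) (by norm_num)

theorem three_tenths_rpow_le : (0.3 : ℝ) ^ (1.894 : ℝ) ≤ 0.10226 :=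
  Real.rpow_le_of_pow_le_pow (p := 947) (q := 500) (by norm_num) (by norm_num) (by norm_num)
    (by norm_num) (by norm_num)

theorem isHost_binary_one : IsHost.{u} 2 1 1 :=
  (isHost_zero.binary_step (n := 1) isHost_zero).mono le_rfl (by norm_num)

theorem isHost_binary_two : IsHost.{u} 2 2 2 :=
  (isHost_binary_one.binary_step (n := 2) isHost_zero).mono le_rfl (by norm_num)

theorem isHost_binary_small {n : ℕ} (h3 : 3 ≤ n) (h6 : n ≤ 6) :
    IsHost.{u} 2 n ((n : ℝ) ^ (1.894 : ℝ) / 2) := by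
  have b3 : IsHost.{u} 2 3 4 :=
    (isHost_binary_two.binary_step (n := 3) isHost_binary_one).mono le_rfl (by norm_num)
  have b4 : IsHost.{u} 2 4 6 :=
    (b3.binary_step (n := 4) isHost_binary_one).mono le_rfl (by norm_num)
  have b5 : IsHost.{u} 2 5 9 :=
    (b4.binary_step (n := 5) isHost_binary_two).mono le_rfl (by norm_num)
  have b6 : IsHost.{u} 2 6 12 :=
    (b5.binary_step (n := 6) isHost_binary_two).mono le_rfl (by norm_num)
  have key : ∀ (k y : ℕ), y ^ 500 ≤ k ^ 947 → (y : ℝ) ≤ (k : ℝ) ^ (1.894 : ℝ) := fun k y h =>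
    Real.le_rpow_of_pow_le_pow (p := 947) (q := 500) (by positivity) (by positivity) (by norm_num)
      (by norm_num) (by exact_mod_cast h)
  interval_cases n
  · refine b3.mono le_rfl ?_
    have := key 3 8 (by norm_num)
    push_cast at this ⊢; linarith
  · refine b4.mono le_rfl ?_
    have := key 4 12 (by norm_num)
    push_cast at this ⊢; linarith
  · refine b5.mono le_rfl ?_
    have := key 5 18 (by norm_num)
    push_cast at this ⊢; linarith
  · refine b6.mono le_rfl ?_
    have := key 6 24 (by norm_num)
    push_cast at this ⊢; linarith

theorem isSpine_binary {n : ℕ}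
    (hh : ∀ j < n, 3 ≤ j → IsHost.{u} 2 j ((j : ℝ) ^ (1.894 : ℝ) / 2)) :
    ∀ m ≤ n, IsSpine.{u} 2 m (1.0826 * (m : ℝ) ^ (1.894 : ℝ)) := by
  have s1 : IsSpine.{u} 2 1 1 :=
    (IsSpine.step one_pos isSpine_zero isSpine_zero isHost_zero.isBundle_one).mono (by norm_num)
  have s2 : IsSpine.{u} 2 2 3 :=
    (IsSpine.step two_pos isSpine_zero s1 isHost_binary_one.isBundle_one).mono (by norm_num)
  have s3 : IsSpine.{u} 2 3 5 :=
    (IsSpine.step three_pos s1 s1 isHost_binary_two.isBundle_one).mono (by norm_num)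
  -- The constant 1.0826 is just above `R / (1 - 2 * 0.26907)`.
  refine isSpine_rpow (R := 1 / 2) (m₀ := 4) (by norm_num) (by norm_num) ?_ ?_ ?_
  · have := half_rpow_binary_le
    linarith
  · intro m hm hm4 _
    interval_cases m
    · exact s1.mono (by norm_num)
    · refine s2.mono ?_
      have : (3 : ℝ) ≤ (2 : ℝ) ^ (1.894 : ℝ) :=
        Real.le_rpow_of_pow_le_pow (p := 947) (q := 500) (by norm_num) (by norm_num) (by norm_num)
          (by norm_num) (by norm_num)
      push_cast; linarith
    · refine s3.mono ?_
      have : (5 : ℝ) ≤ (3 : ℝ) ^ (1.894 : ℝ) :=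
        Real.le_rpow_of_pow_le_pow (p := 947) (q := 500) (by norm_num) (by norm_num) (by norm_num)
          (by norm_num) (by norm_num)
      push_cast; linarith
  · intro m hm hmn
    refine (hh (m - 1) (by omega) (by omega)).isBundle_one.mono ?_
    rw [Nat.cast_sub (by omega), Nat.cast_one]
    have hm' : (4 : ℝ) ≤ m := by exact_mod_cast hm
    have h1 := rpow_add_two_le (y := (m : ℝ) - 1) (by linarith)
    have h2 : ((m : ℝ) - 1 + 1 / 2) ^ (1.894 : ℝ) ≤ (m : ℝ) ^ (1.894 : ℝ) :=
      Real.rpow_le_rpow (by linarith) (by linarith) (by norm_num)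
    linarith

theorem isHost_binary {n : ℕ} (hn : 3 ≤ n) : IsHost.{u} 2 n ((n : ℝ) ^ (1.894 : ℝ) / 2) := by
  induction n using Nat.strong_induction_on with
  | _ n ih =>
  -- From 7 on, `(n - 1) / 2` is at least 3, so the induction hypothesis applies.
  rcases Nat.lt_or_ge 6 n with h6 | h6
  swap
  · exact isHost_binary_small hn h6
  -- The threshold 0.3 n nearly minimises the total, `1.0826 * 0.10226 + (0.50889 + 0.26907) / 2 < 1
  -- / 2`.
  have hs := isSpine_binary ih (3 * n / 10) (by omega)
  have hb := (ih (n - 3 * n / 10 - 1) (by omega) (by omega)).isBundle_two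
    (ih ((n - 1) / 2) (by omega) (by omega))
  refine (hs.isHost hb).mono le_rfl ?_
  have hn0 : (0 : ℝ) ≤ n := by positivity
  have e1 : ((3 * n / 10 : ℕ) : ℝ) ^ (1.894 : ℝ) ≤ 0.10226 * (n : ℝ) ^ (1.894 : ℝ) := by
    refine le_trans ?_ (mul_le_mul_of_nonneg_right three_tenths_rpow_le (by positivity))
    rw [← Real.mul_rpow (by norm_num) hn0]
    refine Real.rpow_le_rpow (by positivity) ?_ (by norm_num)
    have : ((10 * (3 * n / 10) : ℕ) : ℝ) ≤ ((3 * n : ℕ) : ℝ) := by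
      exact_mod_cast Nat.mul_div_le (3 * n) 10
    push_cast at this ⊢
    linarith
  have e2 : ((n - 3 * n / 10 - 1 : ℕ) : ℝ) ^ (1.894 : ℝ) ≤ 0.50889 * (n : ℝ) ^ (1.894 : ℝ) := by
    refine le_trans ?_ (mul_le_mul_of_nonneg_right seven_tenths_rpow_le (by positivity))
    rw [← Real.mul_rpow (by norm_num) hn0]
    refine Real.rpow_le_rpow (by positivity) ?_ (by norm_num)
    have : ((10 * (n - 3 * n / 10 - 1) : ℕ) : ℝ) ≤ ((7 * n : ℕ) : ℝ) := by
      exact_mod_cast (by omega : 10 * (n - 3 * n / 10 - 1) ≤ 7 * n)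
    push_cast at this ⊢
    linarith
  have e3 : (((n - 1) / 2 : ℕ) : ℝ) ^ (1.894 : ℝ) + 2 ≤ 0.26907 * (n : ℝ) ^ (1.894 : ℝ) := by
    refine le_trans ?_ (mul_le_mul_of_nonneg_right half_rpow_binary_le (by positivity))
    rw [← Real.mul_rpow (by norm_num) hn0]
    refine (rpow_add_two_le (by exact_mod_cast (by omega : 3 ≤ (n - 1) / 2))).trans ?_
    refine Real.rpow_le_rpow (by positivity) ?_ (by norm_num)
    have : ((2 * ((n - 1) / 2) + 1 : ℕ) : ℝ) ≤ n := by
      exact_mod_cast (by omega : 2 * ((n - 1) / 2) + 1 ≤ n)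
    push_cast at this ⊢
    linarith
  have e4 : (0 : ℝ) ≤ (n : ℝ) ^ (1.894 : ℝ) := by positivity
  linarith

end Binary

end RootedTree


/-! ### Integral comparison for negative powers -/

namespace Real

/-- The two powers are `exp (d + s)` and `exp (d - s)`, with difference `2 * exp d * sinh s`. Here
`d ≥ 0` because `1 - x ^ 2 ≤ 1`, and `s ≥ p * x` by the first term of the series of `log (1 + x) -
log (1 - x)`. -/
theorem two_mul_le_one_sub_rpow_sub {p x : ℝ} (hp : 0 < p) (hx : 0 < x) (hx1 : x < 1) :
    2 * p * x ≤ (1 - x) ^ (-p) - (1 + x) ^ (-p) := by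
  have hsum : 2 * x ≤ log (1 + x) - log (1 - x) := by
    have h := hasSum_log_sub_log_of_abs_lt_one (x := x) (by rw [abs_of_pos hx]; exact hx1)
    have := le_hasSum h 0 fun j _ => by positivity
    simpa using this
  have hneg : log (1 + x) + log (1 - x) ≤ 0 := by
    rw [← log_mul (by linarith) (by linarith)]
    exact log_nonpos (by nlinarith) (by nlinarith)
  rw [rpow_def_of_pos (by linarith), rpow_def_of_pos (by linarith)]
  set s := p * (log (1 + x) - log (1 - x)) / 2 with hs
  set d := -(p * (log (1 + x) + log (1 - x))) / 2 with hd
  have hs0 : p * x ≤ s := by rw [hs]; nlinarith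
  have hd0 : 0 ≤ d := by rw [hd]; nlinarith
  have e1 : log (1 - x) * -p = d + s := by rw [hs, hd]; ring
  have e2 : log (1 + x) * -p = d + -s := by rw [hs, hd]; ring
  rw [e1, e2, exp_add, exp_add, ← mul_sub]
  have hpx : 0 < p * x := mul_pos hp hx
  have hsinh : 2 * s ≤ exp s - exp (-s) := by
    have := self_le_sinh_iff.2 (hpx.le.trans hs0)
    rw [sinh_eq] at this
    linarith
  have hexp : 1 ≤ exp d := one_le_exp hd0
  nlinarith

/-- The midpoint inequality for a convex integrand over an interval of length 1. -/
theorem mul_rpow_le_sub_half {p k : ℝ} (hp : 0 < p) (hk : 1 / 2 < k) :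
    p * k ^ (-(p + 1)) ≤ (k - 1 / 2) ^ (-p) - (k + 1 / 2) ^ (-p) := by
  have hk0 : 0 < k := by linarith
  have hx1 : 1 / (2 * k) < 1 := by rw [div_lt_one (by linarith)]; linarith
  have h := two_mul_le_one_sub_rpow_sub hp (x := 1 / (2 * k)) (by positivity) hx1
  have e1 : k - 1 / 2 = k * (1 - 1 / (2 * k)) := by field_simp
  have e2 : k + 1 / 2 = k * (1 + 1 / (2 * k)) := by field_simp
  rw [e1, e2, mul_rpow hk0.le (by linarith), mul_rpow hk0.le (by positivity), ← mul_sub]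
  refine le_trans (le_of_eq ?_) (mul_le_mul_of_nonneg_left h (by positivity))
  rw [neg_add, rpow_add hk0, rpow_neg_one]
  field_simp

theorem rpow_sub_le_mul_rpow {p k : ℝ} (hp : 0 < p) (hk : 0 < k) :
    k ^ (-p) - (k + 1) ^ (-p) ≤ p * k ^ (-(p + 1)) := by
  have e : k + 1 = k * (1 + 1 / k) := by field_simp
  have h1 : 1 - p * (1 / k) ≤ (1 + 1 / k) ^ (-p) := by
    rw [rpow_def_of_pos (by positivity)]
    have h2 := log_le_sub_one_of_pos (x := 1 + 1 / k) (by positivity)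
    have h3 := add_one_le_exp (log (1 + 1 / k) * -p)
    nlinarith
  rw [e, mul_rpow hk.le (by positivity)]
  have h2 := mul_le_mul_of_nonneg_left h1 (rpow_nonneg hk.le (-p))
  have h3 : p * k ^ (-(p + 1)) = k ^ (-p) * (p * (1 / k)) := by
    rw [neg_add, rpow_add hk, rpow_neg_one]; field_simp
  rw [h3]
  linarith

end Real

namespace RootedTree

/-! ### General trees, exponent 2.318 -/

section General

/-- The sum of `k ^ (-2.318)` over `2 ≤ k ≤ M`. -/
noncomputable def powerSum (M : ℕ) : ℝ := ∑ k ∈ Finset.Icc 2 M, (k : ℝ) ^ (-2.318 : ℝ)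

/-- The integral of `t ^ (-2.318)` over `t ≥ x`. -/
noncomputable def powerTail (x : ℝ) : ℝ := x ^ (-1.318 : ℝ) / 1.318

theorem powerSum_succ {M : ℕ} (hM : 1 ≤ M) :
    powerSum (M + 1) = powerSum M + ((M + 1 : ℕ) : ℝ) ^ (-2.318 : ℝ) :=
  Finset.sum_Icc_succ_top (by omega) _

theorem powerTail_sub_le {k : ℝ} (hk : 0 < k) :
    powerTail k - powerTail (k + 1) ≤ k ^ (-2.318 : ℝ) := by
  have h := Real.rpow_sub_le_mul_rpow (p := 1.318) (by norm_num) hk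
  norm_num at h ⊢
  rw [powerTail, powerTail]
  norm_num
  linarith

theorem le_powerTail_sub {k : ℝ} (hk : 1 / 2 < k) :
    k ^ (-2.318 : ℝ) ≤ powerTail (k - 1 / 2) - powerTail (k + 1 / 2) := by
  have h := Real.mul_rpow_le_sub_half (p := 1.318) (by norm_num) hk
  norm_num at h ⊢
  rw [powerTail, powerTail]
  norm_num
  linarith

/-- With `powerSum_add_tail_anti`, this brackets ζ(2.318) - 1: the left endpoint overestimates the
integral of a decreasing function, the midpoint underestimates that of a convex one. -/
theorem powerSum_add_tail_mono {M N : ℕ} (hM : 1 ≤ M) (h : M ≤ N) :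
    powerSum M + powerTail (M + 1) ≤ powerSum N + powerTail (N + 1) := by
  induction N, h using Nat.le_induction with
  | base => rfl
  | succ N hN ih =>
    refine ih.trans ?_
    rw [powerSum_succ (hM.trans hN)]
    have := powerTail_sub_le (k := (N : ℝ) + 1) (by positivity)
    push_cast
    linarith

theorem powerSum_add_tail_anti {M N : ℕ} (hM : 1 ≤ M) (h : M ≤ N) :
    powerSum N + powerTail (N + 1 / 2) ≤ powerSum M + powerTail (M + 1 / 2) := by
  induction N, h using Nat.le_induction with
  | base => rfl
  | succ N hN ih =>
    refine le_trans ?_ ih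
    rw [powerSum_succ (hM.trans hN)]
    have := le_powerTail_sub (k := (N : ℝ) + 1) (by have : (0 : ℝ) ≤ N := by positivity
                                                    linarith)
    have e : (N : ℝ) + 1 - 1 / 2 = N + 1 / 2 := by ring
    rw [e] at this
    push_cast
    linarith

theorem powerTail_anti {x y : ℝ} (hx : 0 < x) (hxy : x ≤ y) : powerTail y ≤ powerTail x :=
  div_le_div_of_nonneg_right (Real.rpow_le_rpow_of_nonpos hx hxy (by norm_num)) (by norm_num)

theorem inv_rpow_le {x y : ℝ} (hx : 0 < x) (hy : 0 ≤ y) (h : x⁻¹ ^ 1159 ≤ y ^ 500) :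
    x ^ (-2.318 : ℝ) ≤ y := by
  rw [Real.rpow_neg hx.le, ← Real.inv_rpow hx.le]
  exact Real.rpow_le_of_pow_le_pow (p := 1159) (q := 500) (by positivity) hy (by norm_num)
    (by norm_num) h

theorem half_rpow_general_le : (1 / 2 : ℝ) ^ (2.318 : ℝ) ≤ 0.200546 :=
  Real.rpow_le_of_pow_le_pow (p := 1159) (q := 500) (by norm_num) (by norm_num) (by norm_num)
    (by norm_num) (by norm_num)

theorem powerSum_six_add_tail_le : powerSum 6 + powerTail (6 + 1 / 2) ≤ 0.42318 := by
  have h2 : (2 : ℝ) ^ (-2.318 : ℝ) ≤ 0.200546 :=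
    inv_rpow_le (by norm_num) (by norm_num) (by norm_num)
  have h3 : (3 : ℝ) ^ (-2.318 : ℝ) ≤ 0.07835 :=
    inv_rpow_le (by norm_num) (by norm_num) (by norm_num)
  have h4 : (4 : ℝ) ^ (-2.318 : ℝ) ≤ 0.040219 :=
    inv_rpow_le (by norm_num) (by norm_num) (by norm_num)
  have h5 : (5 : ℝ) ^ (-2.318 : ℝ) ≤ 0.023977 :=
    inv_rpow_le (by norm_num) (by norm_num) (by norm_num)
  have h6 : (6 : ℝ) ^ (-2.318 : ℝ) ≤ 0.015713 :=
    inv_rpow_le (by norm_num) (by norm_num) (by norm_num)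
  have ht : (6 + 1 / 2 : ℝ) ^ (-1.318 : ℝ) ≤ 0.084837 := by
    rw [Real.rpow_neg (by norm_num), ← Real.inv_rpow (by norm_num)]
    exact Real.rpow_le_of_pow_le_pow (p := 659) (q := 500) (by norm_num) (by norm_num)
      (by norm_num) (by norm_num) (by norm_num)
  have ht' : powerTail (6 + 1 / 2) ≤ 0.064369 := by
    rw [powerTail, div_le_iff₀ (by norm_num)]
    refine ht.trans (by norm_num)
  have e : powerSum 6 = (2 : ℝ) ^ (-2.318 : ℝ) + (3 : ℝ) ^ (-2.318 : ℝ) +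
      (4 : ℝ) ^ (-2.318 : ℝ) + (5 : ℝ) ^ (-2.318 : ℝ) + (6 : ℝ) ^ (-2.318 : ℝ) := by
    rw [powerSum_succ (by norm_num), powerSum_succ (by norm_num), powerSum_succ (by norm_num),
      powerSum_succ (by norm_num), powerSum_succ le_rfl]
    simp [powerSum]
  rw [e]
  linarith

theorem powerSum_add_tail_le {M : ℕ} (hM : 1 ≤ M) :
    powerSum M + powerTail (M + 1) ≤ 0.42318 := by
  -- Going up to `max M 6`, passing to the decreasing variant and going back down to 6 gives one
  -- bound for all `M`.
  refine (powerSum_add_tail_mono hM (le_max_left M 6)).trans ?_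
  refine le_trans ?_ ((powerSum_add_tail_anti (M := 6) (by norm_num) (le_max_right M 6)).trans
    powerSum_six_add_tail_le)
  have := powerTail_anti (x := ((max M 6 : ℕ) : ℝ) + 1 / 2) (y := ((max M 6 : ℕ) : ℝ) + 1)
    (by positivity) (by linarith)
  linarith

/-- The size of a host for general trees with at most `n` vertices. -/
noncomputable def hostBound (n : ℕ) : ℝ :=
  if n = 0 then 0 else if n = 1 then 1 else (n : ℝ) ^ (2.318 : ℝ) / 2

@[simp] theorem hostBound_zero : hostBound 0 = 0 := rfl

@[simp] theorem hostBound_one : hostBound 1 = 1 := rfl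

theorem hostBound_of_two_le {n : ℕ} (hn : 2 ≤ n) : hostBound n = (n : ℝ) ^ (2.318 : ℝ) / 2 := by
  rw [hostBound, if_neg (by omega), if_neg (by omega)]

theorem hostBound_mono : Monotone hostBound := by
  have h2 : ∀ n : ℕ, 2 ≤ n → 1 ≤ hostBound n := fun n hn => by
    rw [hostBound_of_two_le hn]
    have h1 : (2 : ℝ) ≤ n := by exact_mod_cast hn
    have := Real.self_le_rpow_of_one_le (x := (n : ℝ)) (y := 2.318) (by linarith) (by norm_num)
    linarith
  intro a b hab
  rcases Nat.lt_or_ge a 2 with ha | ha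
  · rcases Nat.lt_or_ge b 2 with hb | hb
    · interval_cases b <;> interval_cases a <;> simp
    · refine le_trans ?_ (h2 b hb)
      interval_cases a <;> simp
  · rw [hostBound_of_two_le ha, hostBound_of_two_le (ha.trans hab)]
    have : (a : ℝ) ≤ b := by exact_mod_cast hab
    have := Real.rpow_le_rpow (by positivity) this (by norm_num : (0 : ℝ) ≤ 2.318)
    linarith

theorem hostBound_nonneg (n : ℕ) : 0 ≤ hostBound n := hostBound_mono (Nat.zero_le n)

/-- The sum of the sizes of the hosts for all siblings but the largest one. -/
theorem sum_hostBound_le {n M : ℕ} (hn : 2 ≤ n) (hM : M = max 1 ((n - 1) / 2)) (D : ℕ) :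
    1 + ∑ i ∈ Finset.Ico 1 D, hostBound ((n - 1) / (i + 1)) ≤
      (n : ℝ) ^ (2.318 : ℝ) / 2 * powerSum M + (n - M) := by
  rw [Finset.sum_Ico_add' (fun k => hostBound ((n - 1) / k)) 1 D 1]
  have hterm : ∀ k ∈ Finset.Ico 2 (D + 1), hostBound ((n - 1) / k) ≤
      (if k ∈ Finset.Icc 2 M then (n : ℝ) ^ (2.318 : ℝ) / 2 * (k : ℝ) ^ (-2.318 : ℝ) else 0) +
        (if k ∈ Finset.Ioc M (n - 1) then 1 else 0) := by
    intro k hk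
    rw [Finset.mem_Ico] at hk
    -- Beyond `M` the quotient is at most 1, so each such host has at most one vertex; there are at
    -- most `n - 1 - M` nonempty ones.
    rcases Nat.lt_or_ge M k with h1 | h1
    · rw [if_neg (by rw [Finset.mem_Icc]; omega), zero_add]
      rcases Nat.lt_or_ge (n - 1) k with h2 | h2
      · rw [if_neg (by rw [Finset.mem_Ioc]; omega), Nat.div_eq_of_lt h2, hostBound_zero]
      · rw [if_pos (by rw [Finset.mem_Ioc]; omega), ← hostBound_one]
        refine hostBound_mono (Nat.lt_succ_iff.1 ?_)
        rw [Nat.div_lt_iff_lt_mul (by omega)]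
        omega
    · rw [if_pos (by rw [Finset.mem_Icc]; omega), if_neg (by rw [Finset.mem_Ioc]; omega), add_zero]
      have hk0 : (0 : ℝ) < k := by exact_mod_cast (by omega : 0 < k)
      have h2 : 2 ≤ (n - 1) / k := by
        rw [Nat.le_div_iff_mul_le (by omega)]
        omega
      rw [hostBound_of_two_le h2, Real.rpow_neg hk0.le, div_mul_eq_mul_div, ← div_eq_mul_inv,
        ← Real.div_rpow (by positivity) hk0.le]
      refine div_le_div_of_nonneg_right (Real.rpow_le_rpow (by positivity) ?_ (by norm_num))
        (by norm_num)
      refine Nat.cast_div_le.trans (div_le_div_of_nonneg_right ?_ hk0.le)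
      exact_mod_cast Nat.sub_le n 1
  have hsum := Finset.sum_le_sum hterm
  rw [Finset.sum_add_distrib, ← Finset.sum_filter, ← Finset.sum_filter] at hsum
  have h1 : ∑ k ∈ (Finset.Ico 2 (D + 1)).filter (· ∈ Finset.Icc 2 M),
      (n : ℝ) ^ (2.318 : ℝ) / 2 * (k : ℝ) ^ (-2.318 : ℝ) ≤
        (n : ℝ) ^ (2.318 : ℝ) / 2 * powerSum M := by
    rw [powerSum, Finset.mul_sum]
    refine Finset.sum_le_sum_of_subset_of_nonneg (fun k hk => ?_) ?_
    · exact (Finset.mem_filter.1 hk).2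
    intro k _ _
    positivity
  have h2 : ∑ k ∈ (Finset.Ico 2 (D + 1)).filter (· ∈ Finset.Ioc M (n - 1)), (1 : ℝ) ≤
      (n : ℝ) - M - 1 := by
    rw [Finset.sum_const, nsmul_eq_mul, mul_one]
    have hc : ((Finset.Ico 2 (D + 1)).filter (· ∈ Finset.Ioc M (n - 1))).card ≤ n - 1 - M := by
      rw [← Nat.card_Ioc M (n - 1)]
      refine Finset.card_le_card fun k hk => ?_
      exact (Finset.mem_filter.1 hk).2
    have hc' : ((Finset.Ico 2 (D + 1)).filter (· ∈ Finset.Ioc M (n - 1))).card + M + 1 ≤ n := by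
      omega
    have : (((Finset.Ico 2 (D + 1)).filter (· ∈ Finset.Ioc M (n - 1))).card : ℝ) + M + 1 ≤ n := by
      exact_mod_cast hc'
    linarith
  linarith

/-- The one-vertex hosts, about n/2 of them, are charged to the tail of the series, which turns the
partial sum into a bound by ζ(2.318) - 1. -/
theorem le_rpow_mul_powerTail {n M : ℕ} (hn : 5 ≤ n) (hM : M = (n - 1) / 2) :
    (n - M : ℝ) ≤ (n : ℝ) ^ (2.318 : ℝ) / 2 * powerTail (M + 1) := by
  have hn' : (5 : ℝ) ≤ n := by exact_mod_cast hn
  have hn0 : (0 : ℝ) < n := by linarith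
  have hM1 : (M : ℝ) + 1 ≤ (n + 1) / 2 := by
    have : ((2 * M + 1 : ℕ) : ℝ) ≤ n := by exact_mod_cast (by omega : 2 * M + 1 ≤ n)
    push_cast at this
    linarith
  have hM2 : (n : ℝ) - M ≤ n / 2 + 1 := by
    have : (n : ℝ) ≤ ((2 * M + 2 : ℕ) : ℝ) := by exact_mod_cast (by omega : n ≤ 2 * M + 2)
    push_cast at this
    linarith
  refine hM2.trans (le_trans ?_ (mul_le_mul_of_nonneg_left
    (powerTail_anti (by positivity) hM1) (by positivity)))
  have h1 : (n : ℝ) ^ (2.318 : ℝ) / 2 * powerTail ((n + 1) / 2) =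
      n * (n / ((n + 1) / 2)) ^ (1.318 : ℝ) / 2.636 := by
    have e : (n : ℝ) ^ (2.318 : ℝ) = (n : ℝ) ^ (1.318 : ℝ) * n := by
      rw [← Real.rpow_add_one hn0.ne']; norm_num
    rw [powerTail, Real.rpow_neg (by positivity), e, Real.div_rpow hn0.le (by positivity)]
    field_simp
    ring
  -- The ratio `2 n / (n + 1)` increases and is 5/3 at `n = 5`.
  have h2 : (1 + 2 / 3 : ℝ) ≤ n / ((n + 1) / 2) := by
    rw [le_div_iff₀ (by positivity)]
    linarith
  have h3 : 1 + (1.318 : ℝ) * (2 / 3) ≤ (1 + 2 / 3 : ℝ) ^ (1.318 : ℝ) :=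
    one_add_mul_self_le_rpow_one_add (by norm_num) (by norm_num)
  have h4 := h3.trans (Real.rpow_le_rpow (by norm_num) h2 (by norm_num : (0 : ℝ) ≤ 1.318))
  rw [h1]
  have h5 := mul_le_mul_of_nonneg_left h4 hn0.le
  rw [le_div_iff₀ (by norm_num)]
  linarith

theorem le_natCast_rpow (k y : ℕ) (h : y ^ 500 ≤ k ^ 1159) :
    (y : ℝ) ≤ (k : ℝ) ^ (2.318 : ℝ) :=
  Real.le_rpow_of_pow_le_pow (p := 1159) (q := 500) (by positivity) (by positivity) (by norm_num)
    (by norm_num) (by exact_mod_cast h)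

theorem natCast_rpow_le (k y : ℕ) (h : k ^ 1159 ≤ y ^ 500) :
    (k : ℝ) ^ (2.318 : ℝ) ≤ y :=
  Real.rpow_le_of_pow_le_pow (p := 1159) (q := 500) (by positivity) (by positivity) (by norm_num)
    (by norm_num) (by exact_mod_cast h)

theorem sum_hostBound_le_rpow {n : ℕ} (hn : 3 ≤ n) (D : ℕ) :
    1 + ∑ i ∈ Finset.Ico 1 D, hostBound ((n - 1) / (i + 1)) ≤
      0.21159 * (n : ℝ) ^ (2.318 : ℝ) := by
  refine (sum_hostBound_le (by omega) rfl D).trans ?_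
  rcases Nat.lt_or_ge n 5 with h5 | h5
  · interval_cases n
    · have := le_natCast_rpow 3 12 (by norm_num)
      norm_num [powerSum] at this ⊢
      linarith
    · have := le_natCast_rpow 4 24 (by norm_num)
      norm_num [powerSum] at this ⊢
      linarith
  · have hM : max 1 ((n - 1) / 2) = (n - 1) / 2 := max_eq_right (by omega)
    rw [hM]
    have h1 := le_rpow_mul_powerTail h5 rfl
    have h2 := powerSum_add_tail_le (M := (n - 1) / 2) (by omega)
    have h3 := mul_le_mul_of_nonneg_left h2
      (by positivity : 0 ≤ (n : ℝ) ^ (2.318 : ℝ) / 2)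
    linarith

variable {D : ℕ}

theorem isBundle_hostBound {N M : ℕ}
    (hh : ∀ j ≤ M, IsHost.{u} D j (hostBound j)) (k : ℕ) :
    IsBundle.{u} D k N M
      (hostBound M + ∑ i ∈ Finset.Ico 1 k, hostBound (N / (i + 1))) := by
  refine (isBundle_sum (fun j hj _ => hh j hj) k).mono ?_
  rcases Nat.eq_zero_or_pos k with rfl | hk
  · simpa using hostBound_nonneg M
  rw [Finset.range_eq_Ico, Finset.sum_eq_sum_Ico_succ_bot hk]
  refine add_le_add (hostBound_mono (min_le_left _ _)) (Finset.sum_le_sum fun i _ => ?_)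
  exact hostBound_mono (min_le_right _ _)

theorem isSpine_general {n : ℕ} (hh : ∀ j < n, IsHost.{u} D j (hostBound j)) :
    ∀ m ≤ n, IsSpine.{u} D m (1.18816 * (m : ℝ) ^ (2.318 : ℝ)) := by
  -- Spines for `m < 3` are built by hand, since `sum_hostBound_le_rpow` starts at 3.
  have s1 : 1 ≤ n → IsSpine.{u} D 1 1 := fun hn => by
    refine (IsSpine.step one_pos isSpine_zero isSpine_zero (isBundle_hostBound
      (fun j hj => hh j (by omega)) _)).mono ?_
    simp
  -- `R` is 1/2 for the largest off-path child plus 0.21159 for the rest and the root.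
  refine isSpine_rpow (R := 0.71159) (m₀ := 3) (by norm_num) (by norm_num) ?_ ?_ ?_
  · have := half_rpow_general_le
    linarith
  · intro m hm hm3 hmn
    interval_cases m
    · exact (s1 hmn).mono (by norm_num)
    · refine (IsSpine.step two_pos isSpine_zero (s1 (by omega)) (isBundle_hostBound
        (fun j hj => hh j (by omega)) _)).mono ?_
      have h1 := sum_hostBound_le (n := 2) le_rfl rfl (D - 1)
      have h2 := le_natCast_rpow 2 4 (by norm_num)
      norm_num [powerSum] at h1 h2 ⊢
      linarith
  · intro m hm hmn
    refine (isBundle_hostBound (fun j hj => hh j (by omega)) _).mono ?_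
    have h1 := sum_hostBound_le_rpow hm (D - 1)
    have h2 : hostBound (m - 1) ≤ (m : ℝ) ^ (2.318 : ℝ) / 2 := by
      rw [← hostBound_of_two_le (by omega)]
      exact hostBound_mono (Nat.sub_le m 1)
    linarith

theorem isHost_general (n : ℕ) : IsHost.{u} D n (hostBound n) := by
  induction n using Nat.strong_induction_on with
  | _ n ih =>
  rcases Nat.eq_zero_or_pos n with rfl | hn
  · exact isHost_zero
  rcases Nat.lt_or_ge n 5 with h5 | h5
  · refine (isSpine_zero.isHost (n := n) (isBundle_hostBound (M := n - 0 - 1)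
      (fun j hj => ih j (by omega)) _)).mono le_rfl ?_
    rcases eq_or_ne n 1 with rfl | hn1
    · simp
    have h1 := sum_hostBound_le (n := n) (by omega) rfl D
    have h2l := le_natCast_rpow 2 4 (by norm_num)
    have h2u := natCast_rpow_le 2 5 (by norm_num)
    have h3l := le_natCast_rpow 3 12 (by norm_num)
    have h3u := natCast_rpow_le 3 13 (by norm_num)
    have h4l := le_natCast_rpow 4 24 (by norm_num)
    rw [hostBound_of_two_le (n := n) (by omega)]
    interval_cases n
    · exact absurd rfl hn1
    · norm_num [powerSum] at *
      linarith
    · rw [hostBound_of_two_le (n := 3 - 0 - 1) (by norm_num)]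
      norm_num [powerSum] at *
      linarith
    · rw [hostBound_of_two_le (n := 4 - 0 - 1) (by norm_num)]
      norm_num [powerSum] at *
      linarith
  -- The threshold 0.34 n gives the total `1.18816 * 0.08203 + 0.381684 / 2 + 0.21159 < 1 / 2`.
  have hs := isSpine_general (D := D) ih (17 * n / 50) (by omega)
  have hb := isBundle_hostBound (D := D) (N := n - 1) (M := n - 17 * n / 50 - 1)
    (fun j hj => ih j (by omega)) D
  refine (hs.isHost hb).mono le_rfl ?_
  rw [hostBound_of_two_le (n := n) (by omega), hostBound_of_two_le (by omega)]
  have h1 := sum_hostBound_le_rpow (n := n) (by omega) D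
  have hn0 : (0 : ℝ) ≤ n := by positivity
  have e1 : ((17 * n / 50 : ℕ) : ℝ) ^ (2.318 : ℝ) ≤ 0.08203 * (n : ℝ) ^ (2.318 : ℝ) := by
    have hq : (0.34 : ℝ) ^ (2.318 : ℝ) ≤ 0.08203 :=
      Real.rpow_le_of_pow_le_pow (p := 1159) (q := 500) (by norm_num) (by norm_num) (by norm_num)
        (by norm_num) (by norm_num)
    refine le_trans ?_ (mul_le_mul_of_nonneg_right hq (by positivity))
    rw [← Real.mul_rpow (by norm_num) hn0]
    refine Real.rpow_le_rpow (by positivity) ?_ (by norm_num)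
    have : ((50 * (17 * n / 50) : ℕ) : ℝ) ≤ ((17 * n : ℕ) : ℝ) := by
      exact_mod_cast Nat.mul_div_le (17 * n) 50
    push_cast at this ⊢
    linarith
  have e2 : ((n - 17 * n / 50 - 1 : ℕ) : ℝ) ^ (2.318 : ℝ) ≤
      0.381684 * (n : ℝ) ^ (2.318 : ℝ) := by
    have hq : (0.66 : ℝ) ^ (2.318 : ℝ) ≤ 0.381684 :=
      Real.rpow_le_of_pow_le_pow (p := 1159) (q := 500) (by norm_num) (by norm_num) (by norm_num)
        (by norm_num) (by norm_num)
    refine le_trans ?_ (mul_le_mul_of_nonneg_right hq (by positivity))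
    rw [← Real.mul_rpow (by norm_num) hn0]
    refine Real.rpow_le_rpow (by positivity) ?_ (by norm_num)
    have : ((50 * (n - 17 * n / 50 - 1) : ℕ) : ℝ) ≤ ((33 * n : ℕ) : ℝ) := by
      exact_mod_cast (by omega : 50 * (n - 17 * n / 50 - 1) ≤ 33 * n)
    push_cast at this ⊢
    linarith
  have e4 : (0 : ℝ) ≤ (n : ℝ) ^ (2.318 : ℝ) := by positivity
  linarith

end General

/-! ### From numbers of labels to bits -/

/-- Halving the number of labels lowers the logarithm by 1, while rounding up adds strictly less
than 1. -/
theorem NCALabelingScheme.size_lt {𝒯 : Set RootedTree.{u}} {m n : ℕ} (L : NCALabelingScheme 𝒯 m)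
    {c : ℝ} (hc : 1 ≤ c) (hn : 2 ≤ n) (hm : (m : ℝ) ≤ (n : ℝ) ^ c / 2) :
    (L.size : ℝ) < c * Real.logb 2 n := by
  have hn' : (2 : ℝ) ≤ n := by exact_mod_cast hn
  have hn0 : (0 : ℝ) < n := by linarith
  have hlog : 1 ≤ Real.logb 2 n := by
    rw [Real.le_logb_iff_rpow_le (by norm_num) hn0]
    simpa using hn'
  rw [NCALabelingScheme.size]
  rcases Nat.eq_zero_or_pos m with rfl | hm0
  · simp only [Nat.cast_zero, Real.logb_zero, Nat.ceil_zero]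
    nlinarith
  have hm1 : (1 : ℝ) ≤ m := by exact_mod_cast hm0
  have h1 : Real.logb 2 m ≤ c * Real.logb 2 n - 1 := by
    rw [← Real.logb_rpow_eq_mul_logb_of_pos hn0, Real.logb_le_iff_le_rpow (by norm_num) (by linarith),
      Real.rpow_sub (by norm_num), Real.rpow_logb (by norm_num) (by norm_num) (by positivity)]
    simpa using hm
  have h2 := Nat.ceil_lt_add_one (Real.logb_nonneg (by norm_num : (1 : ℝ) < 2) hm1)
  linarith

end RootedTree

theorem mainTheorem2 (n : ℕ) (hn : 2 ≤ n) :
    (∃ (m : ℕ) (L : RootedTree.NCALabelingScheme (RootedTree.treesOfSize.{u} n) m),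
      (L.size : ℝ) < 2.318 * Real.logb 2 (n : ℝ)) ∧
    (∃ (m : ℕ) (L : RootedTree.NCALabelingScheme (RootedTree.binaryTreesOfSize.{u} n) m),
      (L.size : ℝ) < 1.894 * Real.logb 2 (n : ℝ)) := by
  constructor
  -- A tree with at most `n` vertices has degrees at most `n`, and the bound does not depend on `D`.
  · have h := RootedTree.isHost_general.{u} (D := n) n
    rw [RootedTree.hostBound_of_two_le hn] at h
    obtain ⟨m, L, hm⟩ := h.exists_scheme (RootedTree.treesOfSize.{u} n) fun T hT => by
      refine ⟨hT, fun v => Set.encard_le_card.trans ?_⟩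
      have := hT.1
      rw [ENat.card_eq_coe_natCard]
      exact_mod_cast hT.2
    exact ⟨m, L, L.size_lt (by norm_num) hn hm⟩
  · have hb : ∀ T ∈ RootedTree.binaryTreesOfSize.{u} n,
        T ∈ RootedTree.treesOfSize n ∧ RootedTree.DegreeLE 2 T := fun T hT => hT
    -- For `n = 2` the size `n ^ 1.894 / 2` is below 2, too small for a host, but two labels take
    -- only one bit.
    rcases hn.eq_or_lt with rfl | h3
    · obtain ⟨m, L, hm⟩ := RootedTree.isHost_binary_two.exists_scheme _ hb
      refine ⟨m, L, ?_⟩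
      have hsize : L.size ≤ 1 := by
        rw [RootedTree.NCALabelingScheme.size, Nat.ceil_le]
        rcases Nat.eq_zero_or_pos m with rfl | hm0
        · simp
        · rw [Real.logb_le_iff_le_rpow (by norm_num) (by exact_mod_cast hm0)]
          simpa using hm
      have hsize' : (L.size : ℝ) ≤ 1 := by exact_mod_cast hsize
      have : Real.logb 2 ((2 : ℕ) : ℝ) = 1 := Real.logb_self_eq_one (by norm_num)
      rw [this]
      linarith
    · obtain ⟨m, L, hm⟩ := (RootedTree.isHost_binary h3).exists_scheme _ hb
      exact ⟨m, L, L.size_lt (by norm_num) hn hm⟩
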